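/- Let $X$ be a finite set with $\#X\ge 2$, let $F(X)$ be the free group with basis $X$, let $|w|_X$ denote the word length of $w\in F(X)$ with respect to $X$, and let $B_n=\{w\in F(X): |w|_X\le n\}$. A subgroup $H\le F(X)$ is a proper free factor if $H\neq F(X)$ and there is a subgroup $K\le F(X)$ such that $F(X)$ is the internal free product $H*K$. A set $S\subseteq F(X)$ is exponentially $F(X)$-negligible if its complement is exponentially $F(X)$-generic, that is, if $\#((F(X)\setminus S)\cap B_n)/\#B_n$ converges to $1$ exponentially fast: there are constants $C\ge 0$ and $0\le\rho<1$ with $$\left|\frac{\#\big((F(X)\setminus S)\cap B_n\big)}{\#B_n}-1\right|\le C\rho^n\qquad\text{for all } n\ge 0 .$$ Then the set of elements of $F(X)$ that lie in some proper free factor of $F(X)$ is exponentially $F(X)$-negligible. In particular, the set of primitive elements of $F(X)$ (the elements that belong to some free basis of $F(X)$) is exponentially $F(X)$-negligible. -/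

import Mathlib

namespace FreeGenericity

universe u

/-- A subgroup `H` of `G` is a free factor if there is a subgroup `K` of `G` such that `G` is the
internal free product of `H` and `K`: the homomorphism `H ∗ K → G` that extends the two inclusions
is bijective. -/
def IsFreeFactor {G : Type u} [Group G] (H : Subgroup G) : Prop :=
  ∃ K : Subgroup G, Function.Bijective (Monoid.Coprod.lift H.subtype K.subtype)

/-- A proper free factor is a free factor that is not the whole group. -/
def IsProperFreeFactor {G : Type u} [Group G] (H : Subgroup G) : Prop :=
  IsFreeFactor H ∧ H ≠ ⊤

/-- An element is primitive if it belongs to some free basis of the group. -/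
def IsPrimitiveElement {G : Type u} [Group G] (w : G) : Prop :=
  ∃ (ι : Type u) (b : FreeGroupBasis ι G) (i : ι), b i = w

/-- The ball `B_n` of all elements of `F(X)` of word length at most `n` with respect to `X`. -/
def ball (X : Type u) [DecidableEq X] (n : ℕ) : Set (FreeGroup X) :=
  {w | w.norm ≤ n}

/-- For finite `X` the balls are finite, so the cardinalities below are the true ones. -/
theorem finite_ball (X : Type u) [DecidableEq X] [Finite X] (n : ℕ) : (ball X n).Finite :=
  Set.Finite.of_finite_image ((List.finite_length_le (X × Bool) n).subset (by
    rintro _ ⟨w, hw, rfl⟩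
    exact hw)) FreeGroup.toWord_injective.injOn

/-- `S ⊆ T` is exponentially `T`-generic: `#(S ∩ B_n) / #(T ∩ B_n)` converges to `1`
exponentially fast. -/
def IsExponentiallyGeneric {X : Type u} [DecidableEq X] (T S : Set (FreeGroup X)) : Prop :=
  S ⊆ T ∧ ∃ C ρ : ℝ, 0 ≤ C ∧ 0 ≤ ρ ∧ ρ < 1 ∧
    ∀ n : ℕ, |((S ∩ ball X n).ncard : ℝ) / ((T ∩ ball X n).ncard : ℝ) - 1| ≤ C * ρ ^ n

/-- `S ⊆ T` is exponentially `T`-negligible if `T \ S` is exponentially `T`-generic. -/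
def IsExponentiallyNegligible {X : Type u} [DecidableEq X] (T S : Set (FreeGroup X)) : Prop :=
  S ⊆ T ∧ IsExponentiallyGeneric T (T \ S)

end FreeGenericity

/-! An element whose cyclic reduction contains every reduced two-letter word lies in no proper free
factor. Indeed, a splitting H * K with both factors nontrivial separates the ends of the Cayley
tree: it gives a right H-invariant two-colouring with finite coboundary and both colours infinite
(`exists_colouring`). But invariance under such a cyclically reduced word makes one colour finite
(`exists_finite_ne_colour`), since translates of the axis of the word join any two branches leaving
a vertex. Hence proper free factors lie in `missingPair` (`IsProperFreeFactor.subset_missingPair`).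

It remains to count. Put q = 2#X - 1, so that #B_n ≥ q^n. Reduced words avoiding a fixed pair grow
at a rate below q, and a conjugator of length k uses 2k letters for O(q^k) choices. So `missingPair`
has O((n+1)^2 ν^n) elements in B_n for some ν < q. A primitive element generates a cyclic free
factor, which is proper because F(X) is not abelian. -/

namespace FreeGenericity

/-! ### Colourings from free splittings -/

section Colouring

variable {G : Type*} [Group G]

/-- The action of a group on two copies of itself by left multiplication. -/
def leftMulPerm (G : Type*) [Group G] : G →* Equiv.Perm (G × Bool) where
  toFun g := (Equiv.mulLeft g).prodCongr (Equiv.refl Bool)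
  map_one' := by ext ⟨a, b⟩ <;> simp
  map_mul' x y := by ext ⟨a, b⟩ <;> simp [mul_assoc]

@[simp]
theorem leftMulPerm_apply (g : G) (p : G × Bool) : leftMulPerm G g p = (g * p.1, p.2) := rfl

open Classical in
/-- The action of `leftMulPerm`, conjugated by the exchange of the two copies of `1`. -/
noncomputable def twistedLeftMulPerm (G : Type*) [Group G] : G →* Equiv.Perm (G × Bool) :=
  (MulAut.conj (Equiv.swap ((1 : G), false) (1, true))).toMonoidHom.comp (leftMulPerm G)

open Classical in
theorem twistedLeftMulPerm_apply (g : G) (p : G × Bool) :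
    twistedLeftMulPerm G g p = Equiv.swap ((1 : G), false) (1, true)
      (leftMulPerm G g (Equiv.swap ((1 : G), false) (1, true) p)) := by
  simp [twistedLeftMulPerm, MulAut.conj_apply]

theorem twistedLeftMulPerm_apply_of_ne {g x : G} (hx : x ≠ 1) (hg : g * x ≠ 1) (e : Bool) :
    twistedLeftMulPerm G g (x, e) = (g * x, e) := by
  classical
  have h {y : G} (hy : y ≠ 1) : Equiv.swap ((1 : G), false) (1, true) (y, e) = (y, e) :=
    Equiv.swap_apply_of_ne_of_ne (by simp [hy]) (by simp [hy])
  rw [twistedLeftMulPerm_apply, h hx, leftMulPerm_apply, h hg]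

theorem twistedLeftMulPerm_apply_one {g : G} (hg : g ≠ 1) :
    twistedLeftMulPerm G g (1, false) = (g, true) := by
  classical
  rw [twistedLeftMulPerm_apply, Equiv.swap_apply_left,
    leftMulPerm_apply, Equiv.swap_apply_of_ne_of_ne (by simp [hg]) (by simp [hg])]
  simp

theorem twistedLeftMulPerm_apply_fst (g : G) (p : G × Bool) :
    (twistedLeftMulPerm G g p).1 = g * p.1 := by
  classical
  have h (p : G × Bool) : (Equiv.swap ((1 : G), false) (1, true) p).1 = p.1 := by
    rw [Equiv.swap_apply_def]; split_ifs with h1 h2 <;> simp [*]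
  rw [twistedLeftMulPerm_apply, h, leftMulPerm_apply, h]

theorem infinite_of_subgroup_ne_bot [IsMulTorsionFree G] {K : Subgroup G} (hK : K ≠ ⊥)
    {s : Set G} (hs : ∀ k ∈ K, k ≠ 1 → k ∈ s) : s.Infinite := by
  obtain ⟨⟨k, hkK⟩, hk⟩ := Subgroup.ne_bot_iff_exists_ne_one.1 hK
  replace hk : k ≠ 1 := fun h => hk (Subtype.ext h)
  refine Set.infinite_of_injective_forall_mem (f := fun n : ℕ => k ^ (n + 1)) ?_ fun n =>
    hs _ (K.pow_mem hkK _) fun h => hk ((pow_eq_one_iff_left (Nat.succ_ne_zero n)).1 h)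
  exact (IsMulTorsionFree.pow_right_injective hk).comp (add_left_injective 1)

/-- A nontrivial free splitting `G = H * K` yields a two-colouring of `G`, invariant under right
multiplication by `H`, with both colours infinite and with finite coboundary. -/
theorem exists_colouring [IsMulTorsionFree G] {H K : Subgroup G}
    (hHK : Function.Bijective (Monoid.Coprod.lift H.subtype K.subtype)) (hH : H ≠ ⊥) (hK : K ≠ ⊥) :
    ∃ c : G → Bool, (∀ g, ∀ h ∈ H, c (g * h) = c g) ∧ (∀ x, {g | c (g * x) ≠ c g}.Finite) ∧
      ∀ e, {g | c g = e}.Infinite := by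
  let E : Monoid.Coprod H K ≃* G := MulEquiv.ofBijective _ hHK
  -- By the universal property the two factors may act independently: H by translation, K by
  -- translation twisted by the swap. The sheet reached from `(1, false)` is the colour.
  let θ : G →* Equiv.Perm (G × Bool) :=
    (Monoid.Coprod.lift ((leftMulPerm G).comp H.subtype)
      ((twistedLeftMulPerm G).comp K.subtype)).comp E.symm.toMonoidHom
  have hEl (h : H) : E.symm h = Monoid.Coprod.inl h := by
    rw [MulEquiv.symm_apply_eq]; simp [E]
  have hEr (k : K) : E.symm k = Monoid.Coprod.inr k := by
    rw [MulEquiv.symm_apply_eq]; simp [E]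
  have hθH (h : H) : θ h = leftMulPerm G h := by simp [θ, hEl]
  have hθK (k : K) : θ k = twistedLeftMulPerm G k := by simp [θ, hEr]
  have hind {P : G → Prop} (h1 : ∀ h ∈ H, P h) (h2 : ∀ k ∈ K, P k)
      (h3 : ∀ x y, P x → P y → P (x * y)) (x : G) : P x := by
    rw [← E.apply_symm_apply x]
    induction E.symm x using Monoid.Coprod.induction_on with
    | inl h => simpa [E] using h1 h h.2
    | inr k => simpa [E] using h2 k k.2
    | mul x y hx hy => rw [map_mul]; exact h3 _ _ hx hy
  have hfst (x : G) : ∀ p : G × Bool, (θ x p).1 = x * p.1 := by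
    refine hind (P := fun x => ∀ p : G × Bool, (θ x p).1 = x * p.1) ?_ ?_ ?_ x
    · intro h hh p; rw [hθH ⟨h, hh⟩]; simp
    · intro k hk p; rw [hθK ⟨k, hk⟩]; simp [twistedLeftMulPerm_apply_fst]
    · intro x y hx hy p; rw [map_mul, Equiv.Perm.mul_apply, hx, hy, mul_assoc]
  let d : G → Bool := fun g => (θ g (1, false)).2
  have hd (g : G) : θ g (1, false) = (g, d g) := Prod.ext (by simp [hfst]) rfl
  have hdmul (x g : G) : d (x * g) = (θ x (g, d g)).2 := by
    rw [← hd g, ← Equiv.Perm.mul_apply, ← map_mul]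
  have hdH (h : G) (hh : h ∈ H) (g : G) : d (h * g) = d g := by
    rw [hdmul, hθH ⟨h, hh⟩]; simp
  have hfin (x : G) : {g | d (x * g) ≠ d g}.Finite := by
    refine hind (P := fun x => {g | d (x * g) ≠ d g}.Finite) ?_ ?_ ?_ x
    · intro h hh; simp [hdH h hh]
    · intro k hk
      -- The twist is felt only where `g` or `k * g` is 1.
      refine (Set.toFinite {1, k⁻¹}).subset fun g hg => ?_
      by_contra hn
      simp only [Set.mem_insert_iff, Set.mem_singleton_iff, not_or] at hn
      refine hg ?_
      rw [hdmul, hθK ⟨k, hk⟩, twistedLeftMulPerm_apply_of_ne hn.1]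
      exact fun h => hn.2 (eq_inv_of_mul_eq_one_right h)
    · intro x y hx hy
      refine ((hx.preimage (mul_right_injective y).injOn).union hy).subset fun g hg => ?_
      by_contra hn
      simp only [Set.mem_union, Set.mem_preimage, Set.mem_ofPred_eq, not_or, not_not] at hn
      exact hg (by rw [mul_assoc, hn.1, hn.2])
  have hd1 : d 1 = false := by simp [d]
  -- Inversion turns left invariance into right invariance.
  refine ⟨fun g => d g⁻¹, ?_, ?_, ?_⟩
  · intro g h hh
    simp only [mul_inv_rev]
    exact hdH _ (H.inv_mem hh) _
  · intro x
    refine ((hfin x⁻¹).preimage inv_injective.injOn).subset fun g hg => ?_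
    simpa using hg
  · rintro (_ | _)
    · refine infinite_of_subgroup_ne_bot hH fun h hh _ => ?_
      have := hdH h⁻¹ (H.inv_mem hh) 1
      rw [mul_one] at this
      exact this.trans hd1
    · refine infinite_of_subgroup_ne_bot hK fun k hk hk1 => ?_
      have := hdmul k⁻¹ 1
      rw [mul_one, hd1, hθK ⟨k⁻¹, K.inv_mem hk⟩,
        twistedLeftMulPerm_apply_one (by simpa using hk1)] at this
      exact this

end Colouring

/-! ### Primitive elements and cyclic free factors -/

section Primitive

theorem not_commute_of_two_le_card {X : Type*} [Fintype X] (hX : 2 ≤ Fintype.card X) :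
    ∃ x y : FreeGroup X, x * y ≠ y * x := by
  classical
  obtain ⟨a, b, hab⟩ := Fintype.exists_pair_of_one_lt_card hX
  refine ⟨FreeGroup.of a, FreeGroup.of b, fun h => ?_⟩
  have := congrArg FreeGroup.toWord h
  simp [FreeGroup.of, FreeGroup.mul_mk, FreeGroup.reduce, hab, hab.symm] at this

theorem IsPrimitiveElement.isFreeFactor_zpowers {G : Type*} [Group G] {w : G}
    (hw : IsPrimitiveElement w) : IsFreeFactor (Subgroup.zpowers w) := by
  classical
  obtain ⟨ι, b, i, rfl⟩ := hw
  refine ⟨Subgroup.closure (b '' {j | j ≠ i}), ?_⟩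
  set K := Subgroup.closure (b '' {j | j ≠ i}) with hKdef
  set H := Subgroup.zpowers (b i) with hHdef
  have hK (j : ι) (hj : j ≠ i) : b j ∈ K := Subgroup.subset_closure ⟨j, hj, rfl⟩
  let ψ : G →* Monoid.Coprod H K := b.lift fun j =>
    if hj : j = i then Monoid.Coprod.inl ⟨b i, Subgroup.mem_zpowers _⟩
    else Monoid.Coprod.inr ⟨b j, hK j hj⟩
  have hψi : ψ (b i) = Monoid.Coprod.inl ⟨b i, Subgroup.mem_zpowers _⟩ := by
    simp [ψ, FreeGroupBasis.lift]
  have hψj (j : ι) (hj : j ≠ i) : ψ (b j) = Monoid.Coprod.inr ⟨b j, hK j hj⟩ := by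
    simp [ψ, hj, FreeGroupBasis.lift]
  set Φ := Monoid.Coprod.lift H.subtype K.subtype
  have h1 : Φ.comp ψ = MonoidHom.id G := by
    refine b.ext_hom _ _ fun j => ?_
    by_cases hj : j = i
    · subst hj; simp [hψi, Φ]
    · simp [hψj j hj, Φ]
  have h2 : ψ.comp Φ = MonoidHom.id _ := by
    refine Monoid.Coprod.hom_ext ?_ ?_
    · ext ⟨_, n, rfl⟩
      simp only [MonoidHom.comp_apply, Φ, Monoid.Coprod.lift_apply_inl, Subgroup.subtype_apply,
        MonoidHom.id_apply, map_zpow, hψi]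
      rw [← map_zpow]
      rfl
    · ext ⟨k, hk⟩
      simp only [MonoidHom.comp_apply, Φ, Monoid.Coprod.lift_apply_inr, Subgroup.subtype_apply,
        MonoidHom.id_apply]
      induction hk using Subgroup.closure_induction with
      | mem x hx => obtain ⟨j, hj, rfl⟩ := hx; exact hψj j hj
      | one => rw [map_one]; exact (map_one Monoid.Coprod.inr).symm
      | mul x y hx hy ihx ihy => rw [map_mul, ihx, ihy, ← map_mul]; rfl
      | inv x hx ih => rw [map_inv, ih, ← map_inv]; rfl
  exact ⟨Function.LeftInverse.injective (g := ψ) fun x => DFunLike.congr_fun h2 x,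
    Function.RightInverse.surjective (g := ψ) fun x => DFunLike.congr_fun h1 x⟩

theorem IsPrimitiveElement.exists_isProperFreeFactor {X : Type*} [Fintype X]
    (hX : 2 ≤ Fintype.card X) {w : FreeGroup X} (hw : IsPrimitiveElement w) :
    ∃ H : Subgroup (FreeGroup X), IsProperFreeFactor H ∧ w ∈ H := by
  refine ⟨_, ⟨hw.isFreeFactor_zpowers, fun h => ?_⟩, Subgroup.mem_zpowers w⟩
  obtain ⟨x, y, hxy⟩ := not_commute_of_two_le_card hX
  obtain ⟨m, rfl⟩ := Subgroup.mem_zpowers_iff.1 (h ▸ Subgroup.mem_top x)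
  obtain ⟨n, rfl⟩ := Subgroup.mem_zpowers_iff.1 (h ▸ Subgroup.mem_top y)
  exact hxy (Commute.zpow_zpow (Commute.refl w) m n)

end Primitive

end FreeGenericity

namespace FreeGenericity
-- Invariant colourings of the Cayley tree
section Whitehead

open FreeGroup List

variable {X : Type*}

theorem isReduced_invRev {L : List (X × Bool)} (h : IsReduced L) : IsReduced (invRev L) := by
  classical
  rw [isReduced_iff_reduce_eq, reduce_invRev, h.reduce_eq]

theorem mk_singleton_mul_mk_singleton_not (x : X × Bool) : mk [x] * mk [(x.1, !x.2)] = 1 :=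
  Quot.sound (Red.Step.not (L₁ := []) (L₂ := []))

theorem isCyclicallyReduced_invRev {L : List (X × Bool)} (h : IsCyclicallyReduced L) :
    IsCyclicallyReduced (invRev L) := by
  refine ⟨isReduced_invRev h.1, fun a ha b hb hab => ?_⟩
  simp only [invRev, getLast?_reverse, head?_reverse, head?_map, getLast?_map, Option.mem_def,
    Option.map_eq_some_iff] at ha hb
  obtain ⟨a, ha, rfl⟩ := ha
  obtain ⟨b, hb, rfl⟩ := hb
  simpa using (h.2 b hb a ha hab.symm).symm

variable [DecidableEq X] {c : FreeGroup X → Bool}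

/-- All but finitely many of the elements whose reduced word starts with `l` have colour `e`. -/
def IsAlmostColoured (c : FreeGroup X → Bool) (l : List (X × Bool)) (e : Bool) : Prop :=
  {g | l <+: g.toWord ∧ c g ≠ e}.Finite

/-- With `a` the base point, a L^(m+1) has reduced word l y q L^m. These are infinitely many
elements of the cone of l y, all of the colour of `a`. -/
theorem IsAlmostColoured.eq_of_axis {L l p q : List (X × Bool)} {x y : X × Bool} {e : Bool}
    (hL : IsCyclicallyReduced L) (hc : ∀ g, c (g * mk L) = c g)
    (hpq : L = p ++ [(x.1, !x.2), y] ++ q) (hl : IsReduced (l ++ [y]))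
    (he : IsAlmostColoured c (l ++ [y]) e) : c (mk (l ++ [x]) * (mk p)⁻¹) = e := by
  set a := mk (l ++ [x]) * (mk p)⁻¹ with ha
  have hx := mk_singleton_mul_mk_singleton_not x
  have hmk : mk L = mk p * mk [(x.1, !x.2)] * mk [y] * mk q := by
    rw [hpq]; simp [mul_mk]
  have haL : a * mk L = mk (l ++ [y] ++ q) := by
    rw [ha, hmk, ← mul_mk, ← mul_mk, ← mul_mk]
    calc _ = mk l * (mk [x] * mk [(x.1, !x.2)]) * mk [y] * mk q := by group
      _ = _ := by rw [hx, mul_one]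
  have hword (m : ℕ) : (a * mk L ^ (m + 1)).toWord = l ++ [y] ++ (q ++ (replicate m L).flatten) := by
    rw [pow_succ', ← mul_assoc, haL, pow_mk, mul_mk, toWord_mk, append_assoc (l ++ [y])]
    refine IsReduced.reduce_eq (IsReduced.append_overlap hl ?_ (by simp))
    refine (hL.flatten_replicate (m + 1)).isReduced.infix ⟨p ++ [(x.1, !x.2)], [], ?_⟩
    rw [replicate_succ, flatten_cons]
    nth_rw 2 [hpq]
    simp
  have hcm (m : ℕ) : c (a * mk L ^ m) = c a := by
    induction m with
    | zero => simp
    | succ m ih => rw [pow_succ, ← mul_assoc, hc, ih]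
  by_contra hne
  refine Set.infinite_of_injective_forall_mem (f := fun m : ℕ => a * mk L ^ (m + 1)) ?_ ?_ he
  · intro m n h
    have := congrArg (fun g => g.toWord.length) h
    simp only [hword, length_append, length_flatten, map_replicate, sum_replicate,
      smul_eq_mul] at this
    have hpos : 0 < L.length := by rw [hpq]; simp
    exact Nat.eq_of_mul_eq_mul_right hpos (by omega)
  · intro m
    exact ⟨by rw [hword]; exact prefix_append _ _, by rwa [hcm]⟩

/-- The line of translates by powers of L has its two ends in the cones of l x and l y. Passing to
the inverse of L exchanges x and y, and the two base points differ by right multiplication by L. -/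
theorem IsAlmostColoured.unique_of_axis {L l : List (X × Bool)} {x y : X × Bool} {e f : Bool}
    (hL : IsCyclicallyReduced L) (hc : ∀ g, c (g * mk L) = c g)
    (hxy : [(x.1, !x.2), y] <:+: L) (hlx : IsReduced (l ++ [x])) (hly : IsReduced (l ++ [y]))
    (hx : IsAlmostColoured c (l ++ [x]) e) (hy : IsAlmostColoured c (l ++ [y]) f) : e = f := by
  obtain ⟨p, q, hpq⟩ := hxy
  have h1 := hy.eq_of_axis hL hc hpq.symm hly
  have hinv : invRev L = invRev q ++ [(y.1, !y.2), x] ++ invRev p := by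
    rw [← hpq]; simp [invRev]
  have hc' (g : FreeGroup X) : c (g * mk (invRev L)) = c g := by
    rw [← hc (g * mk (invRev L)), ← inv_mk, inv_mul_cancel_right]
  have h2 := hx.eq_of_axis (isCyclicallyReduced_invRev hL) hc' hinv hlx
  have hxx := mk_singleton_mul_mk_singleton_not x
  rw [← h1, ← h2, ← hc (mk (l ++ [x]) * _), ← hpq, ← inv_mk, inv_inv]
  congr 1
  simp only [← mul_mk, show [(x.1, !x.2), y] = [(x.1, !x.2)] ++ [y] from rfl]
  calc _ = mk l * 1 * mk [y] * mk q := by group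
    _ = mk l * (mk [x] * mk [(x.1, !x.2)]) * mk [y] * mk q := by rw [hxx]
    _ = _ := by group

theorem exists_isAlmostColoured_of_succ [Finite X] {L l : List (X × Bool)}
    (hL : IsCyclicallyReduced L) (hc : ∀ g, c (g * mk L) = c g)
    (hpairs : ∀ a b : X × Bool, (a.1 = b.1 → a.2 = b.2) → [a, b] <:+: L)
    (ih : ∀ x, IsReduced (l ++ [x]) → ∃ e, IsAlmostColoured c (l ++ [x]) e) :
    ∃ e, IsAlmostColoured c l e := by
  obtain ⟨e, he⟩ : ∃ e, ∀ x, IsReduced (l ++ [x]) → IsAlmostColoured c (l ++ [x]) e := by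
    by_cases hex : ∃ x, IsReduced (l ++ [x])
    · obtain ⟨x, hx⟩ := hex
      obtain ⟨e, he⟩ := ih x hx
      refine ⟨e, fun y hy => ?_⟩
      rcases eq_or_ne x y with rfl | hne
      · exact he
      obtain ⟨f, hf⟩ := ih y hy
      have := he.unique_of_axis hL hc (hpairs _ _ ?_) hx hy hf
      · rwa [this]
      · intro h1
        by_contra h2
        refine hne (Prod.ext h1 ?_)
        revert h2
        cases x.2 <;> cases y.2 <;> simp
    · push Not at hex
      -- No reduced word properly extends `l`, so either colour serves.
      exact ⟨true, fun x hx => (hex x hx).elim⟩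
  refine ⟨e, ?_⟩
  have hfin :
      (⋃ x : X × Bool, {g | IsReduced (l ++ [x]) ∧ (l ++ [x]) <+: g.toWord ∧ c g ≠ e}).Finite := by
    refine Set.finite_iUnion fun x => ?_
    by_cases hx : IsReduced (l ++ [x])
    · exact (he x hx).subset fun g hg => hg.2
    · simp [hx]
  refine ((Set.finite_singleton (mk l)).union hfin).subset ?_
  rintro g ⟨⟨t, ht⟩, hg⟩
  match t, ht with
  | [], ht => left; rw [Set.mem_singleton_iff, ← mk_toWord (x := g), ← ht, append_nil]
  | x :: t, ht =>
    right
    have hpre : l ++ [x] <+: g.toWord := ⟨t, by simpa using ht⟩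
    exact Set.mem_iUnion.2 ⟨x, isReduced_toWord.infix hpre.isInfix, hpre, hg⟩

/-- The edges where the colour changes start in a ball, so a cone based outside that ball is
monochromatic. -/
theorem exists_length_isAlmostColoured [Finite X]
    (hfin : ∀ x, {g | c (g * x) ≠ c g}.Finite) :
    ∃ N, ∀ l : List (X × Bool), IsReduced l → l.length = N → ∃ e, IsAlmostColoured c l e := by
  have hU : (⋃ z : X × Bool, {g | c (g * mk [z]) ≠ c g}).Finite :=
    Set.finite_iUnion fun z => hfin _
  obtain ⟨N, hN⟩ := (hU.image FreeGroup.norm).bddAbove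
  refine ⟨N + 1, fun l hl hlen => ⟨c (mk l), ?_⟩⟩
  have key (t : List (X × Bool)) : IsReduced (l ++ t) → c (mk (l ++ t)) = c (mk l) := by
    induction t using List.reverseRecOn with
    | nil => simp
    | append_singleton t z ih =>
      intro h
      have hr : IsReduced (l ++ t) := h.infix ⟨[], [z], by simp⟩
      rw [← ih hr]
      by_contra hne
      have := hN ⟨mk (l ++ t), Set.mem_iUnion.2 ⟨z, by simpa [mul_mk] using hne⟩, rfl⟩
      rw [FreeGroup.norm, toWord_mk, hr.reduce_eq] at this
      simp at this
      omega
  refine Set.finite_empty.subset ?_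
  rintro g ⟨⟨t, ht⟩, hg⟩
  refine hg ?_
  rw [← mk_toWord (x := g), ← ht]
  exact key t (ht ▸ isReduced_toWord)

/-- A colouring with finite coboundary that is invariant under a cyclically reduced word containing
all reduced words of length two is constant up to finitely many elements. -/
theorem exists_finite_ne_colour [Finite X] {L : List (X × Bool)}
    (hL : IsCyclicallyReduced L) (hc : ∀ g, c (g * mk L) = c g)
    (hfin : ∀ x, {g | c (g * x) ≠ c g}.Finite)
    (hpairs : ∀ a b : X × Bool, (a.1 = b.1 → a.2 = b.2) → [a, b] <:+: L) :
    ∃ e, {g | c g ≠ e}.Finite := by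
  obtain ⟨N, hN⟩ := exists_length_isAlmostColoured hfin
  have h0 : ∀ l : List (X × Bool), IsReduced l → l.length = 0 → ∃ e, IsAlmostColoured c l e := by
    induction N with
    | zero => exact hN
    | succ n ih =>
      exact ih fun l _ hlen => exists_isAlmostColoured_of_succ hL hc hpairs
        fun x hx => hN _ hx (by simp [hlen])
  obtain ⟨e, he⟩ := h0 [] IsReduced.nil rfl
  exact ⟨e, he.subset fun g hg => ⟨nil_prefix, hg⟩⟩

end Whitehead
end FreeGenericity

namespace FreeGenericity
-- Counting chains by a transfer operator
section Counting

variable {α : Type*} [Fintype α] [DecidableEq α]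

open Classical in
/-- The words of length `n` that, preceded by the letter `z`, form a chain for `S`. -/
noncomputable def chainsFrom (S : α → α → Prop) : ℕ → α → Finset (List α)
  | 0, _ => {[]}
  | n + 1, z => {y | S z y}.toFinset.biUnion fun y => (chainsFrom S n y).image (List.cons y)

theorem mem_chainsFrom {S : α → α → Prop} {n : ℕ} {z : α} {l : List α} :
    l ∈ chainsFrom S n z ↔ l.length = n ∧ (z :: l).IsChain S := by
  classical
  induction n generalizing z l with
  | zero => cases l <;> simp [chainsFrom]
  | succ n ih =>
    cases l with
    | nil => simp [chainsFrom]
    | cons y t =>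
      simp only [chainsFrom, Finset.mem_biUnion, Set.mem_toFinset, Set.mem_ofPred_eq,
        Finset.mem_image, List.cons.injEq, ih, List.length_cons, List.isChain_cons_cons]
      constructor
      · rintro ⟨_, h1, _, ⟨h2, h3⟩, rfl, rfl⟩
        exact ⟨by omega, h1, h3⟩
      · rintro ⟨h1, h2, h3⟩
        exact ⟨y, h2, t, ⟨by omega, h3⟩, rfl, rfl⟩

open Classical in
theorem card_chainsFrom_succ (S : α → α → Prop) (n : ℕ) (z : α) :
    (chainsFrom S (n + 1) z).card = ∑ y with S z y, (chainsFrom S n y).card := by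
  rw [chainsFrom, Finset.card_biUnion]
  · rw [Set.toFinset_ofPred]
    exact Finset.sum_congr rfl fun y _ => Finset.card_image_of_injective _ List.cons_injective
  · intro y _ y' _ hne
    rw [Function.onFun, Finset.disjoint_left]
    simp only [Finset.mem_image]
    rintro _ ⟨s, _, rfl⟩ ⟨t, _, h⟩
    exact hne (List.cons.inj h).1.symm

-- A positive supersolution φ of the transfer operator bounds its growth rate by μ.
open Classical in
theorem card_chainsFrom_le {S : α → α → Prop} {φ : α → ℝ} {μ : ℝ} (hφ : ∀ z, 1 ≤ φ z)
    (hμ : 0 ≤ μ) (h : ∀ z, ∑ y with S z y, φ y ≤ μ * φ z) (n : ℕ) (z : α) :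
    ((chainsFrom S n z).card : ℝ) ≤ μ ^ n * φ z := by
  induction n generalizing z with
  | zero => simpa [chainsFrom] using hφ z
  | succ n ih =>
    rw [card_chainsFrom_succ, Nat.cast_sum]
    calc _ ≤ ∑ y with S z y, μ ^ n * φ y := Finset.sum_le_sum fun y _ => ih y
      _ = μ ^ n * ∑ y with S z y, φ y := by rw [Finset.mul_sum]
      _ ≤ μ ^ n * (μ * φ z) := by gcongr; exact h z
      _ = _ := by ring

open Classical in
theorem pow_le_card_chainsFrom {S : α → α → Prop} {q : ℕ} (h : ∀ z, q ≤ Finset.card {y | S z y}) (n : ℕ)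
    (z : α) : q ^ n ≤ (chainsFrom S n z).card := by
  induction n generalizing z with
  | zero => simp [chainsFrom]
  | succ n ih =>
    rw [card_chainsFrom_succ]
    calc q ^ (n + 1) = q * q ^ n := pow_succ' _ _
      _ ≤ Finset.card {y | S z y} * q ^ n := by gcongr; exact h z
      _ = ∑ y with S z y, q ^ n := by simp
      _ ≤ _ := Finset.sum_le_sum fun y _ => ih y

/-- The words of length `n` that form a chain for `S`. -/
noncomputable def chains (S : α → α → Prop) (n : ℕ) : Finset (List α) :=
  insert [] (Finset.univ.biUnion fun z => (chainsFrom S (n - 1) z).image (List.cons z))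

/-- Only this direction holds: `chains S n` always contains the empty word, and `chains S 0` also
the one-letter words. Upper bounds tolerate this. -/
theorem mem_chains {S : α → α → Prop} {l : List α} (hl : l.IsChain S) :
    l ∈ chains S l.length := by
  cases l with
  | nil => simp [chains]
  | cons z t => simp [chains, mem_chainsFrom, hl]

open Classical in
theorem card_chains_le {S : α → α → Prop} {φ : α → ℝ} {μ : ℝ} (hφ : ∀ z, 1 ≤ φ z)
    (hμ : 1 ≤ μ) (h : ∀ z, ∑ y with S z y, φ y ≤ μ * φ z) (n : ℕ) :
    ((chains S n).card : ℝ) ≤ (1 + ∑ z, φ z) * μ ^ n := by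
  have h1 : (chains S n).card ≤ (∑ z, (chainsFrom S (n - 1) z).card) + 1 :=
    (Finset.card_insert_le _ _).trans (Nat.succ_le_succ (Finset.card_biUnion_le.trans
      (Finset.sum_le_sum fun z _ => Finset.card_image_le)))
  have h2 : ∑ z, ((chainsFrom S (n - 1) z).card : ℝ) ≤ ∑ z, μ ^ n * φ z := by
    refine Finset.sum_le_sum fun z _ => (card_chainsFrom_le hφ (by linarith) h _ z).trans ?_
    have := hφ z
    gcongr
    exact Nat.sub_le n 1
  have h3 : 1 ≤ μ ^ n := one_le_pow₀ hμ
  calc ((chains S n).card : ℝ) ≤ (∑ z, ((chainsFrom S (n - 1) z).card : ℝ)) + 1 := by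
        exact_mod_cast h1
    _ ≤ μ ^ n * (∑ z, φ z) + μ ^ n := by rw [Finset.mul_sum]; gcongr
    _ = _ := by ring

end Counting

/-! ### Growth of reduced words avoiding a pair -/

section ReducedCounting

variable {X : Type*}

/-- The letter `b` is not the inverse of the letter `a`. -/
def NotInverse (a b : X × Bool) : Prop := a.1 = b.1 → a.2 = b.2

theorem notInverse_iff (a b : X × Bool) : NotInverse a b ↔ b ≠ (a.1, !a.2) := by
  obtain ⟨a, s⟩ := a
  obtain ⟨b, t⟩ := b
  by_cases h : a = b <;> cases s <;> cases t <;> simp [NotInverse, h, eq_comm]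

variable [Fintype X] [DecidableEq X]

open Classical in
theorem filter_notInverse (a : X × Bool) :
    ({y | NotInverse a y} : Finset (X × Bool)) = Finset.univ.erase (a.1, !a.2) := by
  ext y; simp only [Finset.mem_filter, notInverse_iff]; simp

open Classical in
theorem card_filter_notInverse (a : X × Bool) :
    Finset.card {y | NotInverse a y} = 2 * Fintype.card X - 1 := by
  rw [filter_notInverse, Finset.card_erase_of_mem (Finset.mem_univ _), Finset.card_univ,
    Fintype.card_prod, Fintype.card_bool, mul_comm]

/-- The chain relation of the reduced words that avoid the subword `ab`. -/
def AvoidRel (a b : X × Bool) (x y : X × Bool) : Prop := NotInverse x y ∧ ¬ (x = a ∧ y = b)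

/-- A positive function on which the transfer operator of `AvoidRel a b` is contracting relative to
that of all reduced words. -/
def avoidWeight (q : ℝ) (a y : X × Bool) : ℝ :=
  4 * q - (if y = a then 2 else 0) + (if y = (a.1, !a.2) then 1 else 0)

theorem sum_avoidWeight {q : ℝ} (hq : (2 * Fintype.card X : ℝ) = q + 1) (a : X × Bool) :
    ∑ y, avoidWeight q a y = 4 * q * (q + 1) - 1 := by
  simp only [avoidWeight, Finset.sum_add_distrib, Finset.sum_sub_distrib, Finset.sum_ite_eq',
    Finset.mem_univ, if_true, Finset.sum_const, Finset.card_univ, Fintype.card_prod,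
    Fintype.card_bool, nsmul_eq_mul, Nat.cast_mul, Nat.cast_ofNat]
  linear_combination 4 * q * hq

-- Row a loses the successor b, so the weight of a can drop by 2, which gives slack to generic rows.
-- Row a⁻¹ omits the light letter a and gains nothing from this, so its own weight is raised by 1.
-- The generic row then reads 4q² - 1 ≤ 4q² - 1/2, which is where 1/(8q) comes from.
open Classical in
theorem sum_avoidRel_avoidWeight_le {q : ℝ} (hq : (2 * Fintype.card X : ℝ) = q + 1) (hq3 : 3 ≤ q)
    {a b : X × Bool} (hab : NotInverse a b) (z : X × Bool) :
    ∑ y with AvoidRel a b z y, avoidWeight q a y ≤ (q - 1 / (8 * q)) * avoidWeight q a z := by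
  have hinv (x : X × Bool) : x ≠ (x.1, !x.2) := fun h => by simpa using congrArg Prod.snd h
  have hR : ∑ y with NotInverse z y, avoidWeight q a y =
      4 * q * (q + 1) - 1 - avoidWeight q a (z.1, !z.2) := by
    rw [filter_notInverse, ← sum_avoidWeight hq a, Finset.sum_erase_eq_sub (Finset.mem_univ _)]
  have hq0 : q * (1 / (8 * q)) = 1 / 8 := by field_simp
  have hq1 : 1 / (8 * q) ≤ 1 / 24 := by
    apply one_div_le_one_div_of_le <;> linarith
  have hq2 : 0 ≤ 1 / (8 * q) := by positivity
  set ε := 1 / (8 * q)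
  by_cases hza : z = a
  · subst hza
    have hfil : ({y | AvoidRel z b z y} : Finset (X × Bool)) =
        ({y | NotInverse z y} : Finset (X × Bool)).erase b := by
      ext y; simp [AvoidRel, and_comm]
    rw [hfil, Finset.sum_erase_eq_sub (by simpa using hab), hR]
    have hb : 4 * q - 2 ≤ avoidWeight q z b := by
      unfold avoidWeight; split_ifs <;> linarith
    have h1 : avoidWeight q z (z.1, !z.2) = 4 * q + 1 := by
      simp [avoidWeight, (hinv z).symm]
    have h2 : avoidWeight q z z = 4 * q - 2 := by simp [avoidWeight, hinv z]
    rw [h1, h2]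
    nlinarith
  · have hfil : ({y | AvoidRel a b z y} : Finset (X × Bool)) =
        ({y | NotInverse z y} : Finset (X × Bool)) := by
      ext y; simp [AvoidRel, hza]
    rw [hfil, hR]
    by_cases hza' : z = (a.1, !a.2)
    · subst hza'
      have h1 : avoidWeight q a (a.1, !!a.2) = 4 * q - 2 := by simp [avoidWeight, hinv a]
      have h2 : avoidWeight q a (a.1, !a.2) = 4 * q + 1 := by
        simp [avoidWeight, (hinv a).symm]
      simp only [h1, h2]
      nlinarith
    · have h1 : avoidWeight q a (z.1, !z.2) = 4 * q + (if (z.1, !z.2) = (a.1, !a.2) then 1 else 0)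
          - (if (z.1, !z.2) = a then 2 else 0) := by simp only [avoidWeight]; ring
      have h2 : avoidWeight q a z = 4 * q := by simp [avoidWeight, hza, hza']
      have h3 : (z.1, !z.2) ≠ (a.1, !a.2) := fun h => hza (by simpa [Prod.ext_iff] using h)
      have h4 : (z.1, !z.2) ≠ a := fun h => hza' (by rw [← h]; simp)
      rw [h1, h2, if_neg h3, if_neg h4]
      nlinarith

end ReducedCounting
end FreeGenericity

namespace FreeGenericity
-- Proper free factors miss a pair
section FreeFactor

open FreeGroup FreeGroup.reduceCyclically

theorem eq_top_of_surjective_lift_bot {G : Type*} [Group G] {H : Subgroup G}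
    (h : Function.Surjective (Monoid.Coprod.lift H.subtype (⊥ : Subgroup G).subtype)) : H = ⊤ := by
  have := MonoidHom.range_eq_top.2 h
  rwa [Monoid.Coprod.range_lift, Subgroup.range_subtype, Subgroup.range_subtype, sup_bot_eq] at this

/-- The elements whose cyclic reduction misses some reduced word of length two. -/
def missingPair (X : Type*) [DecidableEq X] : Set (FreeGroup X) :=
  {w | ∃ a b : X × Bool, NotInverse a b ∧ ¬ [a, b] <:+: reduceCyclically w.toWord}

theorem IsProperFreeFactor.subset_missingPair {X : Type*} [Finite X] [Nonempty X] [DecidableEq X]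
    {H : Subgroup (FreeGroup X)} (hH : IsProperFreeFactor H) :
    (H : Set (FreeGroup X)) ⊆ missingPair X := by
  intro w hw
  by_contra hn
  have hpairs (a b : X × Bool) (hab : NotInverse a b) :
      [a, b] <:+: reduceCyclically w.toWord := by
    by_contra h
    exact hn ⟨a, b, hab, h⟩
  obtain ⟨⟨K, hHK⟩, hHtop⟩ := hH
  have hK : K ≠ ⊥ := by
    rintro rfl
    exact hHtop (eq_top_of_surjective_lift_bot hHK.2)
  have hH : H ≠ ⊥ := by
    rintro rfl
    obtain ⟨x⟩ := ‹Nonempty X›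
    rw [SetLike.mem_coe, Subgroup.mem_bot] at hw
    simpa [hw] using hpairs (x, true) (x, true) fun _ => rfl
  obtain ⟨c, hcH, hfin, hinf⟩ := exists_colouring hHK hH hK
  set γ : FreeGroup X := FreeGroup.mk (conjugator w.toWord) with hγ
  have hw' : γ⁻¹ * w = FreeGroup.mk (reduceCyclically w.toWord) * γ⁻¹ := by
    nth_rw 1 [← mk_toWord (x := w), ← conj_conjugator_reduceCyclically w.toWord]
    rw [← mul_mk, ← mul_mk, ← inv_mk, ← hγ]
    group
  -- Translating the colouring by γ⁻¹ replaces invariance under w by invariance under its cyclic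
  -- reduction.
  obtain ⟨e, he⟩ := exists_finite_ne_colour (c := fun g => c (g * γ⁻¹))
    (reduceCyclically.isCyclicallyReduced isReduced_toWord)
    (fun g => by rw [mul_assoc, ← hw', ← mul_assoc]; exact hcH _ _ hw)
    (fun x => ((hfin (γ * x * γ⁻¹)).preimage (mul_left_injective γ⁻¹).injOn).subset
      fun g hg => by
        simpa only [Set.mem_preimage, Set.mem_ofPred_eq, ← mul_assoc, inv_mul_cancel_right] using hg)
    hpairs
  refine hinf (!e) ((he.image (· * γ⁻¹)).subset fun g hg => ⟨g * γ, ?_, by simp⟩)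
  rw [Set.mem_ofPred_eq] at hg
  simp [hg]

end FreeFactor

/-! ### Exponential estimates -/

section Growth

open FreeGroup FreeGroup.reduceCyclically

variable {X : Type*}

theorem isChain_avoidRel {a b : X × Bool} {l : List (X × Bool)} (hl : IsReduced l)
    (h : ¬ [a, b] <:+: l) : l.IsChain (AvoidRel a b) := by
  rw [List.isChain_iff_forall_rel_of_append_cons_cons]
  rintro x y s t rfl
  refine ⟨List.isChain_iff_forall_rel_of_append_cons_cons.1 hl rfl, ?_⟩
  rintro ⟨rfl, rfl⟩
  exact h ⟨s, t, by simp⟩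

variable [DecidableEq X] [Fintype X]

theorem pow_le_ncard_ball [Nonempty X] (n : ℕ) :
    (2 * Fintype.card X - 1) ^ n ≤ (ball X n).ncard := by
  classical
  obtain ⟨x⟩ := ‹Nonempty X›
  refine (pow_le_card_chainsFrom (S := NotInverse)
    (fun z => (card_filter_notInverse z).ge) n (x, true)).trans ?_
  have hred {l : List (X × Bool)} (hl : l ∈ chainsFrom NotInverse n (x, true)) : IsReduced l :=
    (mem_chainsFrom.1 hl).2.tail
  rw [← Set.ncard_coe_finset]
  refine Set.ncard_le_ncard_of_injOn FreeGroup.mk (fun l hl => ?_) (fun l hl l' hl' h => ?_)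
    (finite_ball X n)
  · exact norm_mk_le.trans (mem_chainsFrom.1 hl).1.le
  · rw [← (hred hl).reduce_eq, ← (hred hl').reduce_eq]
    exact reduce.sound h

/-- Write w as u v u⁻¹ with v its cyclic reduction. The index records the missing pair, |u| and |v|.
-/
theorem exists_finset_missingPair_inter_ball (n : ℕ) :
    ∃ I : Finset (((X × Bool) × (X × Bool)) × (ℕ × ℕ)),
      (∀ i ∈ I, NotInverse i.1.1 i.1.2 ∧ 2 * i.2.1 + i.2.2 ≤ n) ∧
      I.card ≤ Fintype.card ((X × Bool) × (X × Bool)) * (n + 1) ^ 2 ∧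
      (missingPair X ∩ ball X n).ncard ≤ ∑ i ∈ I, (chains (α := X × Bool) NotInverse i.2.1).card *
        (chains (AvoidRel i.1.1 i.1.2) i.2.2).card := by
  classical
  let J : Finset (((X × Bool) × (X × Bool)) × (ℕ × ℕ)) :=
    Finset.univ ×ˢ (Finset.range (n + 1) ×ˢ Finset.range (n + 1))
  let I := J.filter fun i => NotInverse i.1.1 i.1.2 ∧ 2 * i.2.1 + i.2.2 ≤ n
  refine ⟨I, fun i hi => (Finset.mem_filter.1 hi).2, ?_, ?_⟩
  · refine (Finset.card_filter_le _ _).trans_eq ?_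
    rw [Finset.card_product, Finset.card_product, Finset.card_range, Finset.card_univ, sq]
  let U : Finset (FreeGroup X) := I.biUnion fun i =>
    (chains (α := X × Bool) NotInverse i.2.1 ×ˢ chains (AvoidRel i.1.1 i.1.2) i.2.2).image fun p =>
      FreeGroup.mk (p.1 ++ p.2 ++ invRev p.1)
  have hsub : missingPair X ∩ ball X n ⊆ U := by
    rintro w ⟨⟨a, b, hab, hn⟩, hw⟩
    have hconj := conj_conjugator_reduceCyclically w.toWord
    have hlen := congrArg List.length hconj
    simp only [List.length_append, invRev_length] at hlen
    change w.toWord.length ≤ n at hw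
    refine Finset.mem_coe.2 (Finset.mem_biUnion.2 ⟨((a, b), ((conjugator w.toWord).length,
      (reduceCyclically w.toWord).length)), ?_, Finset.mem_image.2
      ⟨(conjugator w.toWord, reduceCyclically w.toWord), Finset.mem_product.2 ⟨?_, ?_⟩, ?_⟩⟩)
    · simp only [I, J, Finset.mem_filter, Finset.mem_product, Finset.mem_univ, Finset.mem_range,
        true_and]
      exact ⟨⟨by omega, by omega⟩, hab, by omega⟩
    · refine mem_chains (isReduced_toWord (x := w) |>.infix ?_)
      exact ⟨[], reduceCyclically w.toWord ++ invRev (conjugator w.toWord), by simpa using hconj⟩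
    · exact mem_chains (isChain_avoidRel
        (reduceCyclically.isCyclicallyReduced isReduced_toWord).isReduced hn)
    · simp only [hconj, mk_toWord]
  calc (missingPair X ∩ ball X n).ncard ≤ (U : Set (FreeGroup X)).ncard :=
        Set.ncard_le_ncard hsub U.finite_toSet
    _ = U.card := Set.ncard_coe_finset U
    _ ≤ _ := Finset.card_biUnion_le.trans (Finset.sum_le_sum fun i _ =>
        Finset.card_image_le.trans (Finset.card_product _ _).le)

theorem exists_ncard_missingPair_inter_ball_le {q : ℝ} (hq : (2 * Fintype.card X : ℝ) = q + 1)
    (hq3 : 3 ≤ q) : ∃ C ν : ℝ, 0 ≤ C ∧ 0 < ν ∧ ν < q ∧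
      ∀ n, ((missingPair X ∩ ball X n).ncard : ℝ) ≤ C * (((n : ℝ) + 1) ^ 2 * ν ^ n) := by
  classical
  set μ := q - 1 / (8 * q) with hμ
  have hε : 1 / (8 * q) ≤ 1 := by rw [div_le_one (by positivity)]; linarith
  have hε' : 0 < 1 / (8 * q) := by positivity
  have hμ1 : 1 ≤ μ := by linarith
  -- The entry √q pays for conjugators: q^k ≤ ν^(2k).
  set ν := max μ √q with hν
  have hν1 : 1 ≤ ν := hμ1.trans (le_max_left _ _)
  have hqν : q ≤ ν ^ 2 := by
    calc q = √q ^ 2 := (Real.sq_sqrt (by linarith)).symm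
      _ ≤ ν ^ 2 := by gcongr; exact le_max_right _ _
  have hνq : ν < q := max_lt (by linarith) (by rw [Real.sqrt_lt' (by linarith)]; nlinarith)
  set D := (1 + ∑ _z : X × Bool, (1 : ℝ)) * (1 + (4 * q * (q + 1) - 1)) with hD
  have hD0 : 0 ≤ D := mul_nonneg (by positivity) (by nlinarith)
  refine ⟨Fintype.card ((X × Bool) × (X × Bool)) * D, ν, by positivity, by linarith, hνq,
    fun n => ?_⟩
  obtain ⟨I, hI, hIcard, hle⟩ := exists_finset_missingPair_inter_ball (X := X) n
  have hterm (i) (hi : i ∈ I) : ((chains (α := X × Bool) NotInverse i.2.1).card : ℝ) *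
      (chains (AvoidRel i.1.1 i.1.2) i.2.2).card ≤ D * ν ^ n := by
    obtain ⟨hab, hn⟩ := hI i hi
    have h1 := card_chains_le (S := NotInverse) (φ := fun _ : X × Bool => (1 : ℝ)) (μ := q)
      (fun _ => le_rfl) (by linarith) (fun z => by
        have : 1 ≤ 2 * Fintype.card X := by
          have : (1 : ℝ) ≤ ((2 * Fintype.card X : ℕ) : ℝ) := by push_cast; linarith
          exact_mod_cast this
        rw [Finset.sum_const, card_filter_notInverse, nsmul_eq_mul, Nat.cast_sub this]
        push_cast
        linarith) i.2.1
    have h2 := card_chains_le (S := AvoidRel i.1.1 i.1.2) (φ := avoidWeight q i.1.1) (μ := μ)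
      (fun z => by unfold avoidWeight; split_ifs <;> linarith) hμ1
      (sum_avoidRel_avoidWeight_le hq hq3 hab) i.2.2
    rw [sum_avoidWeight hq] at h2
    have h3 : q ^ i.2.1 ≤ ν ^ (2 * i.2.1) := by
      rw [pow_mul]; gcongr
    have h4 : μ ^ i.2.2 ≤ ν ^ i.2.2 := by gcongr; exact le_max_left _ _
    have h5 : ν ^ (2 * i.2.1) * ν ^ i.2.2 ≤ ν ^ n := by
      rw [← pow_add]; exact pow_le_pow_right₀ hν1 hn
    calc _ ≤ _ := mul_le_mul h1 h2 (by positivity) (by positivity)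
      _ = D * (q ^ i.2.1 * μ ^ i.2.2) := by rw [hD]; ring
      _ ≤ D * (ν ^ (2 * i.2.1) * ν ^ i.2.2) := by gcongr
      _ ≤ D * ν ^ n := by gcongr
  calc ((missingPair X ∩ ball X n).ncard : ℝ) ≤ ∑ i ∈ I, ((chains (α := X × Bool) NotInverse i.2.1).card : ℝ) *
        (chains (AvoidRel i.1.1 i.1.2) i.2.2).card := by exact_mod_cast hle
    _ ≤ ∑ i ∈ I, D * ν ^ n := Finset.sum_le_sum hterm
    _ = I.card * (D * ν ^ n) := by rw [Finset.sum_const, nsmul_eq_mul]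
    _ ≤ ((Fintype.card ((X × Bool) × (X × Bool)) * (n + 1) ^ 2 : ℕ) : ℝ) * (D * ν ^ n) := by
        gcongr
    _ = _ := by push_cast; ring

theorem exists_sq_mul_pow_le {s : ℝ} (hs0 : 0 < s) (hs1 : s < 1) :
    -- With ρ = √s, one factor ρ^n absorbs the polynomial and the other remains.
    ∃ M ρ : ℝ, 0 ≤ M ∧ 0 ≤ ρ ∧ ρ < 1 ∧ ∀ n : ℕ, ((n : ℝ) + 1) ^ 2 * s ^ n ≤ M * ρ ^ n := by
  set ρ := √s
  have hρ0 : 0 < ρ := Real.sqrt_pos.2 hs0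
  have hρ1 : ρ < 1 := by rw [Real.sqrt_lt' one_pos]; simpa using hs1
  have hs : s = ρ * ρ := (Real.mul_self_sqrt hs0.le).symm
  obtain ⟨M, hM⟩ := (tendsto_pow_const_mul_const_pow_of_lt_one 2 hρ0.le hρ1).bddAbove_range
  have hM' (n : ℕ) : ((n : ℝ) + 1) ^ 2 * ρ ^ (n + 1) ≤ M := by
    simpa using hM ⟨n + 1, rfl⟩
  have hM0 : 0 ≤ M := le_trans (by positivity) (hM' 0)
  refine ⟨M / ρ, ρ, by positivity, hρ0.le, hρ1, fun n => ?_⟩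
  calc ((n : ℝ) + 1) ^ 2 * s ^ n = ((n : ℝ) + 1) ^ 2 * ρ ^ (n + 1) / ρ * ρ ^ n := by
        rw [hs, mul_pow]; field_simp; ring
    _ ≤ M / ρ * ρ ^ n := by gcongr; exact hM' n

theorem isExponentiallyNegligible_univ_of_subset_missingPair (hX : 2 ≤ Fintype.card X)
    {S : Set (FreeGroup X)} (hS : S ⊆ missingPair X) :
    IsExponentiallyNegligible Set.univ S := by
  have : Nonempty X := Fintype.card_pos_iff.1 (by omega)
  set q : ℝ := ((2 * Fintype.card X - 1 : ℕ) : ℝ) with hqdef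
  have hq : (2 * Fintype.card X : ℝ) = q + 1 := by
    rw [hqdef, Nat.cast_sub (by omega)]; push_cast; ring
  have hq3 : 3 ≤ q := by rw [hqdef]; exact_mod_cast (by omega : 3 ≤ 2 * Fintype.card X - 1)
  obtain ⟨C, ν, hC, hν0, hνq, hle⟩ := exists_ncard_missingPair_inter_ball_le hq hq3
  obtain ⟨M, ρ, hM, hρ0, hρ1, hMρ⟩ := exists_sq_mul_pow_le (s := ν / q) (by positivity)
    ((div_lt_one (by linarith)).2 hνq)
  refine ⟨Set.subset_univ _, Set.sdiff_subset, C * M, ρ, by positivity, hρ0, hρ1, fun n => ?_⟩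
  have hball : q ^ n ≤ ((ball X n).ncard : ℝ) := by
    rw [hqdef]; exact_mod_cast pow_le_ncard_ball n
  have hqn : 0 < q ^ n := by positivity
  have hsplit : (((Set.univ \ S) ∩ ball X n).ncard : ℝ) = (ball X n).ncard - (S ∩ ball X n).ncard := by
    have h := Set.ncard_inter_add_ncard_sdiff_eq_ncard (ball X n) S (finite_ball X n)
    have h' : (Set.univ \ S) ∩ ball X n = ball X n \ S := by
      ext; simp [and_comm]
    rw [h', Set.inter_comm S, ← h]
    push_cast
    ring
  have hSle : ((S ∩ ball X n).ncard : ℝ) ≤ C * (((n : ℝ) + 1) ^ 2 * ν ^ n) := by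
    refine le_trans ?_ (hle n)
    exact_mod_cast Set.ncard_le_ncard (Set.inter_subset_inter_left _ hS)
      ((finite_ball X n).subset Set.inter_subset_right)
  have hpos : 0 < ((ball X n).ncard : ℝ) := hqn.trans_le hball
  have hratio : (((ball X n).ncard : ℝ) - (S ∩ ball X n).ncard) / (ball X n).ncard - 1 =
      -((S ∩ ball X n).ncard / (ball X n).ncard) := by
    field_simp
    ring
  rw [Set.univ_inter, hsplit, hratio, abs_neg, abs_of_nonneg (by positivity)]
  calc ((S ∩ ball X n).ncard : ℝ) / (ball X n).ncard
      ≤ C * (((n : ℝ) + 1) ^ 2 * ν ^ n) / q ^ n := by gcongr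
    _ = C * (((n : ℝ) + 1) ^ 2 * (ν / q) ^ n) := by rw [div_pow]; ring
    _ ≤ C * (M * ρ ^ n) := mul_le_mul_of_nonneg_left (hMρ n) hC
    _ = C * M * ρ ^ n := by ring

end Growth
end FreeGenericity

theorem mainTheorem3 {X : Type*} [Fintype X] [DecidableEq X] (hX : 2 ≤ Fintype.card X) :
    FreeGenericity.IsExponentiallyNegligible (Set.univ : Set (FreeGroup X))
        {w | ∃ H : Subgroup (FreeGroup X), FreeGenericity.IsProperFreeFactor H ∧ w ∈ H} ∧
      FreeGenericity.IsExponentiallyNegligible (Set.univ : Set (FreeGroup X))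
        {w | FreeGenericity.IsPrimitiveElement w} := by
  have : Nonempty X := Fintype.card_pos_iff.1 (by omega)
  refine ⟨FreeGenericity.isExponentiallyNegligible_univ_of_subset_missingPair hX ?_,
    FreeGenericity.isExponentiallyNegligible_univ_of_subset_missingPair hX ?_⟩
  · rintro w ⟨H, hH, hw⟩
    exact hH.subset_missingPair hw
  · intro w hw
    obtain ⟨H, hH, hwH⟩ := FreeGenericity.IsPrimitiveElement.exists_isProperFreeFactor hX hw
    exact hH.subset_missingPair hwH
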